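/- There is a universal constant $C>0$ such that the following holds for all $m,n$ and every matrix $A\in\{0,1\}^{m\times n}$ that has at least two distinct rows. Let $\dim(A)$ be the VC dimension of $A$, i.e. the largest size of a set $Y\subseteq[n]$ of columns such that every subset of $Y$ has the form $\{j\in Y : A_{ij}=1\}$ for some row $i$. For a real matrix $B$ with $k$ columns let $\mathrm{disc}(B)=\min_{x\in\{-1,1\}^k}\|Bx\|_\infty$, and let $\mathrm{herdisc}(A)$ be the maximum of $\mathrm{disc}(B)$ over all submatrices $B$ of $A$. Then \[\mathrm{herdisc}(A)\le C\sqrt{n\cdot\dim(A)}.\] Moreover, the bound is witnessed by a uniformly random coloring: for every submatrix $B$ of $A$ with $k$ columns, and $x$ uniformly distributed on $\{-1,1\}^k$, \[\mathbb{E}\,\|Bx\|_\infty\le C\sqrt{n\cdot\dim(A)}.\] -/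

import Mathlib

open scoped BigOperators

noncomputable section

namespace HerDisc

variable {ι κ : Type*} [Fintype ι] [Fintype κ]

/-- The real vector of signs of a colouring; the units of `ℤ` are exactly `1` and `-1`. -/
def signVec (x : κ → ℤˣ) : κ → ℝ := fun j => ((x j : ℤ) : ℝ)

/-- The discrepancy `disc(A, x) = ‖A x‖_∞` of a real matrix with respect to a colouring `x`
(the norm on `ι → ℝ` is the maximum norm). -/
def discColoring (A : Matrix ι κ ℝ) (x : κ → ℤˣ) : ℝ := ‖A.mulVec (signVec x)‖

/-- The discrepancy of a real matrix: the minimum of `‖A x‖_∞` over the finitely many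
colourings `x` of the columns. -/
def disc (A : Matrix ι κ ℝ) : ℝ := ⨅ x : κ → ℤˣ, discColoring A x

/-- The submatrix of `A` with row set `I` and column set `J`. -/
def sub (A : Matrix ι κ ℝ) (I : Finset ι) (J : Finset κ) : Matrix I J ℝ :=
  A.submatrix Subtype.val Subtype.val

/-- The hereditary discrepancy: the maximum of the discrepancies of the finitely many
submatrices of `A`. -/
def herdisc (A : Matrix ι κ ℝ) : ℝ := ⨆ S : Finset ι × Finset κ, disc (sub A S.1 S.2)

open Classical in
/-- The set system on the columns whose incidence matrix is `A`: the supports of the rows. -/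
def rowSets [DecidableEq κ] (A : Matrix ι κ ℝ) : Finset (Finset κ) :=
  Finset.univ.image fun i => Finset.univ.filter fun j => A i j = 1

/-- The VC dimension of a `0/1` matrix: the largest size of a set of columns that is shattered
by the set system of the rows. -/
def vcDim [DecidableEq κ] (A : Matrix ι κ ℝ) : ℕ := (rowSets A).vcDim

end HerDisc

end

namespace HerDisc
open Finset

/-! ### Packing in bounded VC dimension -/

section Packing

variable {κ : Type*} [DecidableEq κ]

/-! The proof is by chaining. In VC dimension `d`, sets pairwise differing in at least `n / 4 ^ k`
points number only `exp (O(d (k + 1)))` (`log_card_le_of_separated`): a random sample keeps them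
distinct, and Sauer–Shelah counts their traces on it. Each row set is therefore reached through ever
finer nets (`exists_net`), the `k`-th link ranging over `exp (O(d (k + 1)))` differences of size at
most `2 n / 4 ^ k`. By exponential moments (`expect_le_of_le_abs`) the largest `k`-th link has
expectation `O((k + 1) 2 ^ (-k) √(n d))`, which is summable in `k`. A single union bound over all
rows would lose a logarithmic factor. Submatrices do not increase the VC dimension, and a minimum is
at most an average, so the random colouring also bounds `herdisc`. -/

lemma vcDim_le_iff {𝓕 : Finset (Finset κ)} {d : ℕ} :
    𝓕.vcDim ≤ d ↔ ∀ U, 𝓕.Shatters U → #U ≤ d := by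
  simp [Finset.vcDim, Finset.sup_le_iff]

/-- The Sauer–Shelah bound for the traces of a set family on a set of points. -/
lemma card_image_inter_le {𝓕 : Finset (Finset κ)} {d : ℕ} (h𝓕 : 𝓕.vcDim ≤ d) (Y : Finset κ) :
    #(𝓕.image (Y ∩ ·)) ≤ ∑ i ∈ range (d + 1), (#Y).choose i := by
  refine (card_le_card_shatterer _).trans ?_
  simp_rw [← card_powersetCard]
  refine (card_le_card fun U hU ↦ ?_).trans card_biUnion_le
  rw [mem_shatterer] at hU
  have hUY : U ⊆ Y := by
    obtain ⟨T, hT, hUT⟩ := hU.exists_superset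
    obtain ⟨S, -, rfl⟩ := mem_image.1 hT
    exact hUT.trans inter_subset_left
  have hU' : 𝓕.Shatters U := by
    intro t ht
    obtain ⟨T, hT, rfl⟩ := hU ht
    obtain ⟨S, hS, rfl⟩ := mem_image.1 hT
    refine ⟨S, hS, ?_⟩
    rw [← inter_assoc, inter_eq_left.2 hUY]
  have := vcDim_le_iff.1 h𝓕 U hU'
  exact mem_biUnion.2 ⟨#U, by simp; omega, mem_powersetCard.2 ⟨hUY, rfl⟩⟩

/-- For `i ≤ d` one has `t ^ d ≤ t ^ i`, so the binomial theorem for `(t + 1) ^ s` dominates the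
weighted sum. The free `t` is later tuned to the sample size. -/
lemma sum_choose_le (s d : ℕ) {t : ℝ} (ht0 : 0 < t) (ht1 : t ≤ 1) :
    ((∑ i ∈ range (d + 1), s.choose i : ℕ) : ℝ) ≤ (t ^ d)⁻¹ * Real.exp (t * s) := by
  have key : t ^ d * ((∑ i ∈ range (d + 1), s.choose i : ℕ) : ℝ) ≤ (t + 1) ^ s := by
    push_cast
    rw [mul_sum, add_pow]
    calc ∑ i ∈ range (d + 1), t ^ d * (s.choose i : ℝ)
        ≤ ∑ i ∈ range (d + 1), t ^ i * (s.choose i : ℝ) := by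
          refine sum_le_sum fun i hi ↦ ?_
          gcongr ?_ * _
          exact pow_le_pow_of_le_one ht0.le ht1 (by simp at hi; omega)
      _ ≤ ∑ i ∈ range (max d s + 1), t ^ i * (s.choose i : ℝ) :=
          sum_le_sum_of_subset_of_nonneg (range_mono (by omega)) fun _ _ _ ↦ by positivity
      _ = ∑ i ∈ range (s + 1), t ^ i * (s.choose i : ℝ) := by
          symm
          refine sum_subset (range_mono (by omega)) fun i _ hi ↦ ?_
          rw [Nat.choose_eq_zero_of_lt (by simp at hi; omega)]
          simp
      _ = _ := by simp
  have h2 : (t + 1) ^ s ≤ Real.exp (t * s) := by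
    rw [mul_comm, Real.exp_nat_mul]
    exact pow_le_pow_left₀ (by positivity) (Real.add_one_le_exp t) s
  rw [inv_mul_eq_div, le_div_iff₀ (by positivity), mul_comm]
  exact key.trans h2

variable [Fintype κ]

/-- A random sample of points distinguishes the members of a well separated family. -/
lemma exists_injOn_inter {𝓖 : Finset (Finset κ)} {Q : ℝ} (hQ : 0 < Q)
    (hsep : ∀ S ∈ 𝓖, ∀ T ∈ 𝓖, S ≠ T → (Fintype.card κ : ℝ) ≤ Q * #(symmDiff S T)) (s : ℕ)
    (hs : (#𝓖 : ℝ) ^ 2 * Real.exp (-(s / Q)) < 1) :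
    ∃ Y : Finset κ, #Y ≤ s ∧ Set.InjOn (Y ∩ ·) (𝓖 : Set (Finset κ)) := by
  rcases isEmpty_or_nonempty κ with hκ | hκ
  · exact ⟨∅, by simp, fun S _ T _ _ ↦ Subsingleton.elim _ _⟩
  set c := Fintype.card κ with hc
  have hc0 : (0 : ℝ) < c := by exact_mod_cast Fintype.card_pos
  -- The samples, drawn with repetition, that miss the symmetric difference and so fail to tell the
  -- pair apart.
  let bad : Finset κ × Finset κ → Finset (Fin s → κ) := fun p ↦
    Fintype.piFinset fun _ ↦ (symmDiff p.1 p.2)ᶜ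
  have hbad : ∀ p ∈ 𝓖.offDiag, ((#(bad p) : ℕ) : ℝ) ≤ c ^ s * Real.exp (-(s / Q)) := by
    intro p hp
    obtain ⟨h1, h2, h3⟩ := mem_offDiag.1 hp
    have h := hsep _ h1 _ h2 h3
    have hle : #(symmDiff p.1 p.2) ≤ c := card_le_univ _
    have hcard : #(bad p) = (c - #(symmDiff p.1 p.2)) ^ s := by
      rw [Fintype.card_piFinset_const, card_compl, ← hc]
    rw [hcard, Nat.cast_pow, Nat.cast_sub hle]
    have e1 : Real.exp (-(s / Q)) = Real.exp (-(1 / Q)) ^ s := by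
      rw [← Real.exp_nat_mul]; congr 1; ring
    rw [e1, ← mul_pow]
    refine pow_le_pow_left₀ (sub_nonneg.2 (by exact_mod_cast hle)) ?_ s
    have e2 := Real.add_one_le_exp (-(1 / Q))
    have e3 : (c : ℝ) * (1 / Q) ≤ #(symmDiff p.1 p.2) := by
      rw [mul_one_div, div_le_iff₀ hQ]; linarith
    nlinarith
  have hlt : #(𝓖.offDiag.biUnion bad) < #(univ : Finset (Fin s → κ)) := by
    have h1 : ((#(𝓖.offDiag.biUnion bad) : ℕ) : ℝ) < (c : ℝ) ^ s := by
      calc ((#(𝓖.offDiag.biUnion bad) : ℕ) : ℝ)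
          ≤ ∑ p ∈ 𝓖.offDiag, ((#(bad p) : ℕ) : ℝ) := by exact_mod_cast card_biUnion_le
        _ ≤ ∑ p ∈ 𝓖.offDiag, (c ^ s * Real.exp (-(s / Q))) := sum_le_sum hbad
        _ = #𝓖.offDiag * (c ^ s * Real.exp (-(s / Q))) := by simp
        _ ≤ (#𝓖 : ℝ) ^ 2 * (c ^ s * Real.exp (-(s / Q))) := by
            gcongr
            rw [offDiag_card, sq]
            exact_mod_cast Nat.sub_le _ _
        _ = c ^ s * ((#𝓖 : ℝ) ^ 2 * Real.exp (-(s / Q))) := by ring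
        _ < c ^ s * 1 := by gcongr
        _ = c ^ s := mul_one _
    have h2 : #(univ : Finset (Fin s → κ)) = c ^ s := by simp [hc]
    rw [h2]
    exact_mod_cast h1
  obtain ⟨f, -, hf⟩ := exists_mem_notMem_of_card_lt_card hlt
  refine ⟨univ.image f, card_image_le.trans (by simp), fun S hS T hT hST ↦ ?_⟩
  by_contra hne
  refine hf (mem_biUnion.2 ⟨(S, T), mem_offDiag.2 ⟨hS, hT, hne⟩, Fintype.mem_piFinset.2 fun i ↦ ?_⟩)
  have := Finset.ext_iff.1 hST (f i)
  simp only [mem_inter, mem_image_of_mem f (mem_univ i), true_and] at this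
  rw [mem_compl, mem_symmDiff]
  tauto

/-- A packing bound for set families of bounded VC dimension. -/
lemma log_card_le_of_separated {𝓖 : Finset (Finset κ)} {d : ℕ} (hd : 1 ≤ d) (h𝓖 : 𝓖.vcDim ≤ d)
    (k : ℕ) (hsep : ∀ S ∈ 𝓖, ∀ T ∈ 𝓖, S ≠ T →
      (Fintype.card κ : ℝ) ≤ 4 ^ k * #(symmDiff S T)) :
    Real.log #𝓖 ≤ 4 * d * (k + 1) := by
  rcases 𝓖.eq_empty_or_nonempty with rfl | hne
  · simp; positivity
  have hN : (0 : ℝ) < #𝓖 := by exact_mod_cast hne.card_pos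
  have hN1 : (1 : ℝ) ≤ #𝓖 := by exact_mod_cast hne.card_pos
  set L := Real.log #𝓖 with hL
  have hL0 : 0 ≤ L := Real.log_nonneg hN1
  set Q : ℝ := 4 ^ k with hQ
  have hQ0 : 0 < Q := by positivity
  have hQ1 : 1 ≤ Q := one_le_pow₀ (by norm_num)
  set s := ⌊2 * Q * L⌋₊ + 1 with hs
  have hs1 : 2 * Q * L < s := by rw [hs]; push_cast; exact Nat.lt_floor_add_one _
  have hs2 : (s : ℝ) ≤ 2 * Q * L + 1 := by
    rw [hs]; push_cast; gcongr; exact Nat.floor_le (by positivity)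
  obtain ⟨Y, hY, hinj⟩ := exists_injOn_inter hQ0 hsep s (by
    have : (#𝓖 : ℝ) ^ 2 = Real.exp (2 * L) := by
      rw [two_mul, Real.exp_add, hL, Real.exp_log hN, sq]
    rw [this, ← Real.exp_add, Real.exp_lt_one_iff]
    have : 2 * L < s / Q := by rw [lt_div_iff₀ hQ0]; linarith
    linarith)
  have h1 := card_image_inter_le h𝓖 Y
  rw [card_image_of_injOn hinj] at h1
  -- With `t = 1 / (4 Q)` and about `2 Q L` samples, the exponent is about `L / 2`, which the left
  -- side absorbs.
  have h2 : (#𝓖 : ℝ) ≤ (((4 * Q)⁻¹) ^ d)⁻¹ * Real.exp ((4 * Q)⁻¹ * #Y) :=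
    le_trans (by exact_mod_cast h1)
      (sum_choose_le #Y d (by positivity) (inv_le_one_of_one_le₀ (by linarith)))
  have h3 : L ≤ d * ((k + 1) * Real.log 4) + (4 * Q)⁻¹ * #Y := by
    have := Real.log_le_log hN h2
    rw [Real.log_mul (by positivity) (by positivity), Real.log_exp] at this
    have e : Real.log (4 * Q) = (k + 1) * Real.log 4 := by
      rw [hQ, ← pow_succ', Real.log_pow, Nat.cast_succ]
    rwa [inv_pow, inv_inv, Real.log_pow, e] at this
  have h4 : (4 * Q)⁻¹ * #Y ≤ L / 2 + 1 / 4 := by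
    rw [inv_mul_le_iff₀ (by positivity)]
    have : (#Y : ℝ) ≤ s := by exact_mod_cast hY
    nlinarith
  have h5 : Real.log 4 ≤ 1.4 := by
    have : (4 : ℝ) = 2 ^ 2 := by norm_num
    rw [this, Real.log_pow]
    have := Real.log_two_lt_d9
    push_cast; linarith
  have hd' : (1 : ℝ) ≤ d := by exact_mod_cast hd
  have h6 : (1 : ℝ) ≤ d * (k + 1) := by
    have : (0 : ℝ) ≤ k := by positivity
    nlinarith
  have h7 : d * ((k + 1) * Real.log 4) ≤ (d * (k + 1)) * 1.4 := by
    rw [← mul_assoc]; gcongr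
  linarith

/-- Every set family contains a separated net at each scale. -/
lemma exists_net (𝓕 : Finset (Finset κ)) (Q : ℝ) :
    ∃ 𝓖 ⊆ 𝓕,
      (∀ S ∈ 𝓖, ∀ T ∈ 𝓖, S ≠ T → (Fintype.card κ : ℝ) ≤ Q * #(symmDiff S T)) ∧
      ∀ S ∈ 𝓕, ∃ T ∈ 𝓖, Q * #(symmDiff S T) ≤ Fintype.card κ := by
  classical
  -- A separated subfamily of maximal size is a net, since an uncovered set could be added to it.
  obtain ⟨𝓖, h𝓖, hmax⟩ := exists_max_image (𝓕.powerset.filter fun 𝓖 ↦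
    ∀ S ∈ 𝓖, ∀ T ∈ 𝓖, S ≠ T → (Fintype.card κ : ℝ) ≤ Q * #(symmDiff S T)) card ⟨∅, by simp⟩
  rw [mem_filter, mem_powerset] at h𝓖
  refine ⟨𝓖, h𝓖.1, h𝓖.2, fun S hS ↦ ?_⟩
  by_contra! hcon
  have hSG : S ∉ 𝓖 := fun h ↦ by
    have := hcon S h
    simp at this
    exact this.not_ge (by positivity)
  have := hmax (insert S 𝓖) (by
    rw [mem_filter, mem_powerset]
    refine ⟨insert_subset hS h𝓖.1, fun A hA B hB hAB ↦ ?_⟩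
    rw [mem_insert] at hA hB
    rcases hA with rfl | hA <;> rcases hB with rfl | hB
    · exact absurd rfl hAB
    · exact (hcon B hB).le
    · rw [symmDiff_comm]; exact (hcon A hA).le
    · exact h𝓖.2 A hA B hB hAB)
  rw [card_insert_of_notMem hSG] at this
  omega


end Packing

/-! ### Exponential moments of random signs -/

section Signs

variable {κ : Type*} [Fintype κ] [DecidableEq κ]

lemma expect_exp_signVec (w : κ → ℝ) :
    Finset.expect univ (fun x : κ → ℤˣ ↦ Real.exp (∑ j, w j * signVec x j))
      = ∏ j, Real.cosh (w j) := by
  rw [Fintype.expect_eq_sum_div_card]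
  have h1 : ∑ x : κ → ℤˣ, Real.exp (∑ j, w j * signVec x j)
      = ∏ j, ∑ u : ℤˣ, Real.exp (w j * ((u : ℤ) : ℝ)) := by
    rw [prod_univ_sum, Fintype.piFinset_univ]
    exact sum_congr rfl fun x _ ↦ Real.exp_sum _ _
  have h2 : ∀ j, ∑ u : ℤˣ, Real.exp (w j * ((u : ℤ) : ℝ)) = 2 * Real.cosh (w j) := by
    intro j
    have : (univ : Finset ℤˣ) = {1, -1} := rfl
    rw [this, sum_pair (by decide), Real.cosh_eq]
    simp
    ring
  rw [h1, prod_congr rfl fun j _ ↦ h2 j, prod_mul_distrib]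
  simp

lemma expect_exp_signVec_le (w : κ → ℝ) :
    Finset.expect univ (fun x : κ → ℤˣ ↦ Real.exp (∑ j, w j * signVec x j))
      ≤ Real.exp ((∑ j, w j ^ 2) / 2) := by
  rw [expect_exp_signVec, sum_div, Real.exp_sum]
  exact prod_le_prod (fun j _ ↦ (Real.cosh_pos _).le) fun j _ ↦ Real.cosh_le_exp_half_sq _

/-- The maximal inequality for finitely many signed sums. -/
lemma expect_le_of_le_abs {ι : Type*} (V : Finset ι) (w : ι → κ → ℝ) {σ2 l : ℝ} (hl : 0 < l)
    (hw : ∀ v ∈ V, ∑ j, w v j ^ 2 ≤ σ2) (M : (κ → ℤˣ) → ℝ)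
    (hM : ∀ x, ∃ v ∈ V, M x ≤ |∑ j, w v j * signVec x j|) :
    Finset.expect univ M ≤ (Real.log (2 * #V) + l ^ 2 * σ2 / 2) / l := by
  have hV : (0 : ℝ) < #V := by
    obtain ⟨v, hv, -⟩ := hM 1
    exact_mod_cast card_pos.2 ⟨v, hv⟩
  set a : ℝ := 2 * #V * Real.exp (l ^ 2 * σ2 / 2) with ha
  have ha0 : 0 < a := by positivity
  have hlog : Real.log a = Real.log (2 * #V) + l ^ 2 * σ2 / 2 := by
    rw [ha, Real.log_mul (by positivity) (by positivity), Real.log_exp]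
  -- The tangent line of `exp` at `log a` plays the role of Jensen's inequality; `a` bounds the
  -- expectation of the sum.
  have hpt : ∀ x, l * M x ≤ Real.log a - 1 +
      (∑ v ∈ V, (Real.exp (∑ j, (l * w v j) * signVec x j)
        + Real.exp (∑ j, (-(l * w v j)) * signVec x j))) / a := by
    intro x
    obtain ⟨v, hv, hMv⟩ := hM x
    have h1 : Real.exp (l * M x) ≤ Real.exp (∑ j, (l * w v j) * signVec x j)
        + Real.exp (∑ j, (-(l * w v j)) * signVec x j) := by
      have e1 : ∑ j, (l * w v j) * signVec x j = l * ∑ j, w v j * signVec x j := by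
        rw [mul_sum]; exact sum_congr rfl fun _ _ ↦ by ring
      have e2 : ∑ j, (-(l * w v j)) * signVec x j = l * -∑ j, w v j * signVec x j := by
        rw [← sum_neg_distrib, mul_sum]; exact sum_congr rfl fun _ _ ↦ by ring
      rw [e1, e2]
      rcases abs_cases (∑ j, w v j * signVec x j) with ⟨h, -⟩ | ⟨h, -⟩
      · exact le_add_of_le_of_nonneg (Real.exp_le_exp.2 (by gcongr; linarith)) (Real.exp_pos _).le
      · exact le_add_of_nonneg_of_le (Real.exp_pos _).le (Real.exp_le_exp.2 (by gcongr; linarith))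
    have h2 := h1.trans (single_le_sum (s := V) (f := fun v ↦
      Real.exp (∑ j, (l * w v j) * signVec x j) + Real.exp (∑ j, (-(l * w v j)) * signVec x j))
      (fun _ _ ↦ by positivity) hv)
    have h3 := Real.add_one_le_exp (l * M x - Real.log a)
    rw [Real.exp_sub, Real.exp_log ha0] at h3
    have h4 := div_le_div_of_nonneg_right h2 ha0.le
    linarith
  have hE : Finset.expect univ (fun x ↦ l * M x) ≤ Real.log a := by
    refine (expect_le_expect fun x _ ↦ hpt x).trans ?_
    rw [expect_add_distrib, expect_const univ_nonempty, ← expect_div, expect_sum_comm]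
    have : ∑ v ∈ V, Finset.expect univ (fun x : κ → ℤˣ ↦
        (Real.exp (∑ j, (l * w v j) * signVec x j)
          + Real.exp (∑ j, (-(l * w v j)) * signVec x j))) ≤ a := by
      calc _ ≤ ∑ v ∈ V, 2 * Real.exp (l ^ 2 * σ2 / 2) := by
            refine sum_le_sum fun v hv ↦ ?_
            rw [expect_add_distrib, two_mul]
            have e : l ^ 2 * ∑ j, w v j ^ 2 ≤ l ^ 2 * σ2 := by gcongr; exact hw v hv
            refine add_le_add ((expect_exp_signVec_le _).trans ?_)
              ((expect_exp_signVec_le _).trans ?_) <;>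
            · refine Real.exp_le_exp.2 ?_
              simp only [neg_sq, mul_pow, ← mul_sum]
              gcongr
        _ = a := by rw [sum_const, nsmul_eq_mul, ha]; ring
    have := div_le_one_of_le₀ this ha0.le
    linarith
  rw [← mul_expect] at hE
  rw [le_div_iff₀ hl, ← hlog, mul_comm]
  exact hE

end Signs


/-! ### Chaining through the nets -/

section Chaining

variable {κ : Type*} [Fintype κ] [DecidableEq κ]

lemma sum_sub_indicator_sq (S T : Finset κ) :
    ∑ j, ((if j ∈ S then (1 : ℝ) else 0) - if j ∈ T then 1 else 0) ^ 2
      = ((#(symmDiff S T) : ℕ) : ℝ) := by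
  rw [card_eq_sum_ones, Nat.cast_sum, ← sum_filter_add_sum_filter_not univ (· ∈ symmDiff S T)]
  have h1 : ∀ j ∈ univ.filter (· ∈ symmDiff S T),
      ((if j ∈ S then (1 : ℝ) else 0) - if j ∈ T then 1 else 0) ^ 2 = 1 := by
    intro j hj
    rcases mem_symmDiff.1 (mem_filter.1 hj).2 with ⟨h, h'⟩ | ⟨h, h'⟩ <;> simp [h, h']
  have h2 : ∀ j ∈ univ.filter (¬ · ∈ symmDiff S T),
      ((if j ∈ S then (1 : ℝ) else 0) - if j ∈ T then 1 else 0) ^ 2 = 0 := by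
    intro j hj
    have := (mem_filter.1 hj).2
    rw [mem_symmDiff] at this
    by_cases h : j ∈ S <;> by_cases h' : j ∈ T <;> simp_all
  rw [sum_congr rfl h1, sum_congr rfl h2]
  simp

lemma sum_range_linear_div_two_pow_le (K : ℕ) :
    ∑ k ∈ range K, (8 * (k : ℝ) + 14) / 2 ^ k ≤ 44 := by
  have : ∑ k ∈ range K, (8 * (k : ℝ) + 14) / 2 ^ k = 44 - (16 * K + 44) / 2 ^ K := by
    induction K with
    | zero => norm_num
    | succ K ih => rw [sum_range_succ, ih, pow_succ]; push_cast; field_simp; ring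
  rw [this]
  have : (0 : ℝ) ≤ (16 * K + 44) / 2 ^ K := by positivity
  linarith

/-- The expected maximal discrepancy of a set family under a uniformly random colouring. -/
theorem expect_le_of_vcDim_le [Nonempty κ] {𝓕 : Finset (Finset κ)} {d : ℕ} (hd : 1 ≤ d)
    (h𝓕 : 𝓕.vcDim ≤ d) (M : (κ → ℤˣ) → ℝ)
    (hM : ∀ x, ∃ S ∈ 𝓕, M x ≤ |∑ j ∈ S, signVec x j|) :
    Finset.expect univ M ≤ 50 * Real.sqrt (Fintype.card κ * d) := by
  set n := Fintype.card κ with hn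
  have hn0 : (0 : ℝ) < n := by exact_mod_cast Fintype.card_pos
  have hd1 : (1 : ℝ) ≤ d := by exact_mod_cast hd
  have hd0 : (0 : ℝ) < d := by linarith
  choose S hS hMS using hM
  choose G hGsub hGsep hGnet using fun k : ℕ ↦ exists_net 𝓕 ((4 : ℝ) ^ k)
  choose! p hpG hpd using hGnet
  have hlogG : ∀ k, Real.log #(G k) ≤ 4 * d * (k + 1) := fun k ↦
    log_card_le_of_separated hd ((vcDim_mono (hGsub k)).trans h𝓕) k (hGsep k)
  have hGpos : ∀ k, (0 : ℝ) < #(G k) := fun k ↦ by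
    exact_mod_cast card_pos.2 ⟨_, hpG k _ (hS 1)⟩
  have hlog2 : Real.log 2 ≤ 1 := by linarith [Real.log_two_lt_d9]
  -- Since `n < 4 ^ n`, the net at level `n` approximates within less than one point, so the chain
  -- ends exactly.
  have hlast : ∀ T ∈ 𝓕, p n T = T := by
    intro T hT
    have h1 := hpd n T hT
    by_contra hne
    have h2 : (1 : ℝ) ≤ #(symmDiff T (p n T)) := by
      have : (symmDiff T (p n T)).Nonempty := by
        rw [nonempty_iff_ne_empty]
        exact fun h ↦ hne (symmDiff_eq_bot.1 h).symm
      exact_mod_cast this.card_pos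
    have h3 : (n : ℝ) < 4 ^ n := by exact_mod_cast Nat.lt_pow_self (by norm_num : 1 < 4)
    have h4 : (4 : ℝ) ^ n * 1 ≤ 4 ^ n * #(symmDiff T (p n T)) := by gcongr
    linarith
  set r := Real.sqrt (n * d) with hr
  -- This choice balances the entropy `d / l` against the variance term `l * n`.
  set l := Real.sqrt d / Real.sqrt n with hl
  have hl0 : 0 < l := by positivity
  have hln : l ^ 2 * n = d := by
    rw [hl, div_pow, Real.sq_sqrt hd0.le, Real.sq_sqrt hn0.le]; field_simp
  have hdl : d / l = r := by
    rw [hr, hl, Real.sqrt_mul hn0.le, div_div_eq_mul_div, div_eq_iff (by positivity)]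
    rw [mul_assoc, Real.mul_self_sqrt hd0.le, mul_comm]
  let u : Finset κ → κ → ℝ := fun T j ↦ if j ∈ T then 1 else 0
  let f : ℕ → (κ → ℤˣ) → ℝ := fun k x ↦ ∑ j, u (p k (S x)) j * signVec x j
  have hpt : ∀ x, M x ≤ |f 0 x| + ∑ k ∈ range n, |f (k + 1) x - f k x| := by
    intro x
    have h1 : ∑ j ∈ S x, signVec x j = f n x := by simp [f, u, hlast _ (hS x)]
    have h2 := sum_range_sub (fun k ↦ f k x) n
    have h3 := abs_sum_le_sum_abs (fun k ↦ f (k + 1) x - f k x) (range n)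
    rw [h2] at h3
    have h4 := hMS x
    rw [h1] at h4
    have h5 := abs_sub_abs_le_abs_sub (f n x) (f 0 x)
    linarith
  have hbase : Finset.expect univ (fun x ↦ |f 0 x|) ≤ 6 * r := by
    have h := expect_le_of_le_abs (G 0) u (σ2 := n) hl0 (fun T _ ↦ by
      have := sum_sub_indicator_sq T ∅
      simp only [notMem_empty, if_false, sub_zero] at this
      rw [this]
      exact_mod_cast card_le_univ _) (fun x ↦ |f 0 x|)
      fun x ↦ ⟨p 0 (S x), hpG 0 _ (hS x), le_rfl⟩
    refine h.trans ?_
    rw [Real.log_mul two_ne_zero (hGpos 0).ne', hln, ← hdl, ← mul_div_assoc]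
    have := hlogG 0
    gcongr
    norm_num at this
    linarith
  have hstep : ∀ k, Finset.expect univ (fun x ↦ |f (k + 1) x - f k x|)
      ≤ (8 * (k : ℝ) + 14) / 2 ^ k * r := by
    intro k
    -- Only close pairs can be links. The variance shrinks by `4 ^ k`, so `l` is scaled by `2 ^ k`
    -- to keep the variance term equal to `d`.
    have h := expect_le_of_le_abs (G (k + 1) ×ˢ G k |>.filter fun q ↦
        4 ^ k * (#(symmDiff q.1 q.2) : ℝ) ≤ 2 * n) (fun q j ↦ u q.1 j - u q.2 j)
      (σ2 := 2 * n / 4 ^ k) (l := 2 ^ k * l) (by positivity) (fun q hq ↦ by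
        rw [sum_sub_indicator_sq, le_div_iff₀' (by positivity)]
        exact (mem_filter.1 hq).2) (fun x ↦ |f (k + 1) x - f k x|) (fun x ↦ by
        refine ⟨(p (k + 1) (S x), p k (S x)), ?_, le_of_eq ?_⟩
        · rw [mem_filter, mem_product]
          refine ⟨⟨hpG _ _ (hS x), hpG _ _ (hS x)⟩, ?_⟩
          have h1 := hpd (k + 1) _ (hS x)
          have h2 := hpd k _ (hS x)
          have h3 : (#(symmDiff (p (k + 1) (S x)) (p k (S x))) : ℝ)
              ≤ #(symmDiff (S x) (p (k + 1) (S x))) + #(symmDiff (S x) (p k (S x))) := by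
            have := (card_le_card (symmDiff_triangle (p (k + 1) (S x)) (S x) (p k (S x)))).trans
              (card_union_le _ _)
            rw [symmDiff_comm (p (k + 1) (S x)) (S x)] at this
            exact_mod_cast this
          rw [pow_succ] at h1
          have h4 : (4 : ℝ) ^ k * #(symmDiff (S x) (p (k + 1) (S x))) ≤ n := by
            have : (0 : ℝ) ≤ 4 ^ k * #(symmDiff (S x) (p (k + 1) (S x))) := by positivity
            linarith
          have h5 := mul_le_mul_of_nonneg_left h3 (by positivity : (0 : ℝ) ≤ 4 ^ k)
          linarith
        · simp only [f, sub_mul, sum_sub_distrib])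
    refine h.trans ?_
    set V := (G (k + 1) ×ˢ G k).filter fun q ↦ 4 ^ k * (#(symmDiff q.1 q.2) : ℝ) ≤ 2 * n with hV
    -- The two nets give `4 d (k + 2) + 4 d (k + 1)`, and `log 2 ≤ d` gives the last unit.
    have hVlog : Real.log (2 * #V) ≤ d * (8 * k + 13) := by
      rcases V.eq_empty_or_nonempty with h0 | h0
      · rw [h0]; simp; positivity
      have h0' : (0 : ℝ) < #V := by exact_mod_cast h0.card_pos
      have h1 : (#V : ℝ) ≤ #(G (k + 1)) * #(G k) := by
        exact_mod_cast (card_filter_le _ _).trans (card_product _ _).le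
      have h2 := Real.log_le_log h0' h1
      rw [Real.log_mul (hGpos _).ne' (hGpos _).ne'] at h2
      rw [Real.log_mul two_ne_zero h0'.ne']
      have h3 := hlogG (k + 1)
      have h4 := hlogG k
      push_cast at h3
      linarith
    have hvar : (2 ^ k * l) ^ 2 * (2 * n / 4 ^ k) / 2 = d := by
      rw [mul_pow, ← pow_mul, mul_comm k 2, pow_mul, ← hln]
      norm_num
      field_simp
    rw [hvar, ← hdl]
    have : (8 * (k : ℝ) + 14) / 2 ^ k * (d / l) = (d * (8 * k + 13) + d) / (2 ^ k * l) := by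
      field_simp; ring
    rw [this]
    gcongr
  calc Finset.expect univ M
      ≤ Finset.expect univ fun x ↦ |f 0 x| + ∑ k ∈ range n, |f (k + 1) x - f k x| :=
        expect_le_expect fun x _ ↦ hpt x
    _ = Finset.expect univ (fun x ↦ |f 0 x|)
        + ∑ k ∈ range n, Finset.expect univ (fun x ↦ |f (k + 1) x - f k x|) := by
        rw [expect_add_distrib, expect_sum_comm]
    _ ≤ 6 * r + ∑ k ∈ range n, (8 * (k : ℝ) + 14) / 2 ^ k * r :=
        add_le_add hbase (sum_le_sum fun k _ ↦ hstep k)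
    _ ≤ 6 * r + 44 * r := by
        rw [← sum_mul]
        gcongr
        exact sum_range_linear_div_two_pow_le n
    _ = 50 * r := by ring

end Chaining

/-! ### From set families to matrices -/

section Matrices

variable {ι κ : Type*} [Fintype ι] [Fintype κ] [DecidableEq κ]

/-- A column where two rows differ is shattered. This rules out dimension zero, where one nonzero
row already violates the bound. -/
lemma one_le_vcDim {A : Matrix ι κ ℝ} (hA : ∀ i j, A i j = 0 ∨ A i j = 1)
    (hrows : ∃ i i', A i ≠ A i') : 1 ≤ vcDim A := by
  classical
  obtain ⟨i, i', hne⟩ := hrows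
  obtain ⟨j, hj⟩ := Function.ne_iff.1 hne
  wlog h : A i j = 0 generalizing i i'
  · exact this i' i hne.symm hj.symm (by
      rcases hA i j with h1 | h1
      · exact absurd h1 h
      · exact (hA i' j).resolve_right fun h2 ↦ hj (h1.trans h2.symm))
  have h' : A i' j = 1 := (hA i' j).resolve_left fun h2 ↦ hj (h.trans h2.symm)
  have : (rowSets A).Shatters {j} := by
    intro t ht
    rcases subset_singleton_iff.1 ht with rfl | rfl
    · exact ⟨_, mem_image_of_mem _ (mem_univ i), by simp [h]⟩
    · exact ⟨_, mem_image_of_mem _ (mem_univ i'), by simp [h']⟩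
  exact this.card_le_vcDim

lemma vcDim_sub_le (A : Matrix ι κ ℝ) (I : Finset ι) (J : Finset κ) :
    vcDim (sub A I J) ≤ vcDim A := by
  classical
  refine vcDim_le_iff.2 fun U hU ↦ ?_
  have : (rowSets A).Shatters (U.map (Function.Embedding.subtype _)) := by
    intro t ht
    obtain ⟨t', ht', rfl⟩ := subset_map_iff.1 ht
    obtain ⟨R, hR, rfl⟩ := hU ht'
    obtain ⟨i, -, rfl⟩ := mem_image.1 hR
    refine ⟨_, mem_image_of_mem _ (mem_univ i.1), ?_⟩
    ext j
    rw [mem_inter, mem_map, mem_map, mem_filter]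
    constructor
    · rintro ⟨⟨a, ha, rfl⟩, h⟩
      exact ⟨a, mem_inter.2 ⟨ha, mem_filter.2 ⟨mem_univ _, h.2⟩⟩, rfl⟩
    · rintro ⟨a, h, rfl⟩
      obtain ⟨ha, h⟩ := mem_inter.1 h
      exact ⟨⟨a, ha, rfl⟩, mem_univ _, (mem_filter.1 h).2⟩
  exact (card_map _).ge.trans this.card_le_vcDim

lemma exists_discColoring_eq [Nonempty ι] {A : Matrix ι κ ℝ}
    (hA : ∀ i j, A i j = 0 ∨ A i j = 1) (x : κ → ℤˣ) :
    ∃ S ∈ rowSets A, discColoring A x = |∑ j ∈ S, signVec x j| := by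
  classical
  obtain ⟨i, hi⟩ := (IsGreatest.pi_norm (A.mulVec (signVec x))).1
  refine ⟨_, mem_image_of_mem _ (mem_univ i), ?_⟩
  rw [discColoring, ← hi]
  simp only [Real.norm_eq_abs, Matrix.mulVec, dotProduct, sum_filter]
  congr 1
  refine sum_congr rfl fun j _ ↦ ?_
  rcases hA i j with h | h <;> simp [h]

theorem expect_discColoring_le {A : Matrix ι κ ℝ} (hA : ∀ i j, A i j = 0 ∨ A i j = 1) {d : ℕ}
    (hd : 1 ≤ d) (hAd : vcDim A ≤ d) :
    Finset.expect univ (discColoring A) ≤ 50 * Real.sqrt (Fintype.card κ * d) := by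
  rcases isEmpty_or_nonempty ι with hι | hι
  · refine expect_le univ_nonempty fun x _ ↦ ?_
    rw [discColoring, Subsingleton.elim (A.mulVec (signVec x)) 0, norm_zero]
    positivity
  rcases isEmpty_or_nonempty κ with hκ | hκ
  · refine expect_le univ_nonempty fun x _ ↦ ?_
    rw [discColoring, Subsingleton.elim (signVec x) 0, Matrix.mulVec_zero, norm_zero]
    positivity
  refine expect_le_of_vcDim_le hd hAd _ fun x ↦ ?_
  obtain ⟨S, hS, h⟩ := exists_discColoring_eq hA x
  exact ⟨S, hS, h.le⟩

lemma disc_le_expect (A : Matrix ι κ ℝ) : disc A ≤ Finset.expect univ (discColoring A) :=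
  le_expect univ_nonempty fun x _ ↦ ciInf_le (Set.finite_range _).bddBelow x

end Matrices

end HerDisc

theorem lemma11 :
    ∃ C : ℝ, 0 < C ∧
      ∀ (m n : ℕ) (A : Matrix (Fin m) (Fin n) ℝ),
        (∀ i j, A i j = 0 ∨ A i j = 1) →
        (∃ i i' : Fin m, A i ≠ A i') →
          HerDisc.herdisc A ≤ C * Real.sqrt ((n : ℝ) * (HerDisc.vcDim A : ℝ)) ∧
          ∀ (I : Finset (Fin m)) (J : Finset (Fin n)),
            Finset.expect (Finset.univ : Finset (J → ℤˣ))
                (fun x => HerDisc.discColoring (HerDisc.sub A I J) x)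
              ≤ C * Real.sqrt ((n : ℝ) * (HerDisc.vcDim A : ℝ)) := by
  refine ⟨50, by norm_num, fun m n A hA hrows ↦ ?_⟩
  have hexp : ∀ (I : Finset (Fin m)) (J : Finset (Fin n)),
      Finset.expect (Finset.univ : Finset (J → ℤˣ))
          (fun x => HerDisc.discColoring (HerDisc.sub A I J) x)
        ≤ 50 * Real.sqrt ((n : ℝ) * (HerDisc.vcDim A : ℝ)) := by
    intro I J
    -- The parameter is the dimension of `A` itself: a submatrix may have dimension zero.
    refine (HerDisc.expect_discColoring_le (fun i j ↦ hA i.1 j.1)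
      (HerDisc.one_le_vcDim hA hrows) (HerDisc.vcDim_sub_le A I J)).trans ?_
    have : (Fintype.card J : ℝ) ≤ n := by
      rw [Fintype.card_coe]
      exact_mod_cast (Finset.card_le_univ J).trans (Fintype.card_fin n).le
    gcongr
  exact ⟨ciSup_le fun S ↦ (HerDisc.disc_le_expect _).trans (hexp S.1 S.2), hexp⟩
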